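/- **Setting.** An arena $(V,V_0,V_1,E,D)$ consists of a countable set $V$ partitioned into $V_0$ (vertices of Player $0$) and $V_1$ (vertices of Player $1$), edges $E\subseteq V\times V$ such that every vertex has an $E$-successor, and disturbance edges $D\subseteq V_0\times V$. A one-counter safety game $\mathcal G$ with disturbances is given by a finite set $Q$ of states with an initial state $q_I$, a one-letter stack alphabet $\Gamma=\{A\}$ with bottom symbol $\bot\notin\Gamma$, a subset $Q_0\subseteq Q$ (the states of Player $0$; Player $1$ owns $Q_1=Q\setminus Q_0$), two transition relations $\mathcal E\subseteq Q\times\Gamma_\bot\times Q\times\Gamma_\bot^{\le 2}$ and $\Delta\subseteq Q_0\times\Gamma_\bot\times Q\times\Gamma_\bot^{\le 2}$ (where $\Gamma_\bot=\Gamma\cup\{\bot\}$), both neither writing nor deleting $\bot$, and a set $F\subseteq Q$; for all $q\in Q$ and $X\in\Gamma_\bot$ there is a transition $(q,X,q',w)\in\mathcal E$. It induces the arena whose vertices are the configurations $(q,A^n\bot)$, of stack height $\mathrm{sh}(q,A^n\bot)=n$, owned by the owner of $q$, and whose sets $E$ and $D$ are the one-step relations of $\mathcal E$ and $\Delta$ (a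 transition $(q,X,q',w)$ replaces the topmost stack symbol $X$ by $w$ and moves from $q$ to $q'$). We also write $F$ for the set of configurations with state in $F$. Let $v_I=(q_I,\bot)$. The rigged arena has the vertices $V'=V\cup\{\overline v\mid v\in V_0\}\cup D\cup\{(v,v')\in E\mid v\in V_1\}$, with $V_0'=\{\overline v\mid v\in V_0\}$ and $V_1'=V'\setminus V_0'$, no disturbance edges, and the following set $E'$ of edges: $v\to(v,v')$ and $(v,v')\to v'$ for $(v,v')\in D$; $v\to\overline v$ for $v\in V_0$; $\overline v\to v'$ for $v\in V_0$ and $(v,v')\in E$; $v\to(v,v')$ and $(v,v')\to v'$ for $(v,v')\in E$ with $v\in V_1$. The stack height of $\overline v$ is $\mathrm{sh}(v)$, and that of an auxiliary vertex $(v,v')$ is $\max(\mathrm{sh}(v),\mathrm{sh}(v'))$. For $k\in\mathbb N$, the rigged game $\mathcal G_k$ is played in the rigged arena. A play $v_0v_1v_2\cdots$ is winning for Player $0$ if it visits vertices in $D$ at least $k$ times, or if $v_0\in V$ and $v_0v_2v_4\cdots$ is a sequence of vertices of $V$ that never visits $F$; otherwise it is winning for Player $1$. Player $1$ wins $\mathcal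 G_k$ from $v_I$ if he has a strategy, i.e. a function assigning to each word in $(V')^*V_1'$ an $E'$-successor of its last vertex, such that every play that starts in $v_I$ and is consistent with it is winning for him. A strategy graph for $\mathcal G_k$ is a tuple $(V^\circ,E^\circ,\mu_r^\circ,\mu_d^\circ)$ with $\mu_r^\circ\colon V^\circ\to\{0,\ldots,k-1\}$ and $\mu_d^\circ\colon V^\circ\to\{0,\ldots,|V^\circ|\}$ such that 1. $(V^\circ,E^\circ)$ is a directed graph with $V^\circ\subseteq V'$, $E^\circ\subseteq E'$, $v_I\in V^\circ$, and $\mathrm{sh}(v)\le(2k)^{|Q|^2}$ for all $v\in V^\circ$; 2. for all $v\in(V^\circ\cap V_0')\setminus F$ and all $(v,v')\in E'$, we have $(v,v')\in E^\circ$; 3. for all $v\in(V^\circ\cap V_1')\setminus F$ there is a unique edge $(v,v')\in E'$ with $(v,v')\in E^\circ$; 4. for all $(v,v')\in E^\circ$, we have $\mu_r^\circ(v)\ge\mu_r^\circ(v')$, with strict inequality if $v\in D$; 5. for all $(v,v')\in E^\circ$, we have $\mu_d^\circ(v)>\mu_d^\circ(v')$. **Lemma.** Let $\mathcal G$ be a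 one-counter safety game with disturbances and let $k\in\mathbb N$. Player $1$ wins $\mathcal G_k$ from $v_I$ if and only if there exists a strategy graph for $\mathcal G_k$. -/

import Mathlib

/-! ### Infinite games with disturbances -/

/-- An arena `(V, V₀, V₁, E, D)` with unmodeled intermittent disturbances on the vertex type `V`;
`V₁` is the complement of `V₀`. -/
structure Arena (V : Type*) where
  countable : Countable V
  V₀ : Set V
  E : V → V → Prop
  D : V → V → Prop
  disturb_source : ∀ v v', D v v' → v ∈ V₀
  exists_succ : ∀ v, ∃ v', E v v'

/-- The set of vertices of Player `i`. -/
def Arena.owned {V : Type*} (A : Arena V) (i : Fin 2) : Set V :=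
  if i = 0 then A.V₀ else A.V₀ᶜ

/-- A play: an infinite sequence of vertices and bits, where the bit at position `j + 1` tells
whether the move from position `j` to `j + 1` used a disturbance edge. -/
structure Play {V : Type*} (A : Arena V) where
  vertex : ℕ → V
  bit : ℕ → Bool
  bit_zero : bit 0 = false
  standard : ∀ j, bit (j + 1) = false → A.E (vertex j) (vertex (j + 1))
  disturbed : ∀ j, bit (j + 1) = true → A.D (vertex j) (vertex (j + 1))

/-- The number of disturbances in a play. -/
noncomputable def Play.disturbances {V : Type*} {A : Arena V} (ρ : Play A) : ℕ∞ :=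
  Set.encard {j | ρ.bit j = true}

/-- A strategy for Player `i`. The word `v₀ ⋯ v_j` is given to `next` as the list
`[v₀, …, v_(j-1)]` together with the last vertex `v_j`. Only the values at words whose last vertex
belongs to Player `i` matter. -/
structure Strategy {V : Type*} (A : Arena V) (i : Fin 2) where
  next : List V → V → V
  next_edge : ∀ w v, v ∈ A.owned i → A.E v (next w v)

/-- `ρ` is consistent with `σ`. -/
def Play.ConsistentWith {V : Type*} {A : Arena V} {i : Fin 2} (ρ : Play A)
    (σ : Strategy A i) : Prop :=
  ∀ j, ρ.vertex j ∈ A.owned i → ρ.bit (j + 1) = false →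
    ρ.vertex (j + 1) = σ.next ((List.range j).map ρ.vertex) (ρ.vertex j)

/-- A game: an arena with a winning condition (for Player 0). -/
structure Game (V : Type*) where
  arena : Arena V
  win : Set (ℕ → V)

/-- The play `ρ` is winning for Player `i`. -/
def Game.IsWinning {V : Type*} (G : Game V) (i : Fin 2) (ρ : Play G.arena) : Prop :=
  if i = 0 then ρ.vertex ∈ G.win else ρ.vertex ∉ G.win

/-- Player `i` wins `G` from `v` (in the classical sense, i.e. without disturbances). -/
def Game.WinsFrom {V : Type*} (G : Game V) (i : Fin 2) (v : V) : Prop :=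
  ∃ σ : Strategy G.arena i, ∀ ρ : Play G.arena,
    ρ.vertex 0 = v → ρ.disturbances = 0 → ρ.ConsistentWith σ → G.IsWinning i ρ

/-- The safety condition: `F` is never visited. -/
def Safety {V : Type*} (F : Set V) : Set (ℕ → V) :=
  {u | ∀ j, u j ∉ F}

/-! ### Rigged games -/

/-- The vertices of the rigged arena: the original vertices, a copy `v̄` of each `v ∈ V₀`, the
disturbance edges, and the standard edges that start in `V₁`. -/
inductive RigVertex {V : Type*} (A : Arena V) where
  | orig (v : V) : RigVertex A
  | copy (v : V) (hv : v ∈ A.V₀) : RigVertex A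
  | dist (v v' : V) (h : A.D v v') : RigVertex A
  | edge (v v' : V) (hv : v ∉ A.V₀) (h : A.E v v') : RigVertex A

/-- The edges of the rigged arena. -/
inductive RigEdge {V : Type*} (A : Arena V) : RigVertex A → RigVertex A → Prop
  | toDist (v v' : V) (h : A.D v v') : RigEdge A (.orig v) (.dist v v' h)
  | ofDist (v v' : V) (h : A.D v v') : RigEdge A (.dist v v' h) (.orig v')
  | toCopy (v : V) (hv : v ∈ A.V₀) : RigEdge A (.orig v) (.copy v hv)
  | ofCopy (v v' : V) (hv : v ∈ A.V₀) (h : A.E v v') : RigEdge A (.copy v hv) (.orig v')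
  | toEdge (v v' : V) (hv : v ∉ A.V₀) (h : A.E v v') : RigEdge A (.orig v) (.edge v v' hv h)
  | ofEdge (v v' : V) (hv : v ∉ A.V₀) (h : A.E v v') : RigEdge A (.edge v v' hv h) (.orig v')

/-- The vertices of the rigged arena that signify a simulated disturbance. -/
def RigVertex.IsDist {V : Type*} {A : Arena V} : RigVertex A → Prop
  | .dist _ _ _ => True
  | _ => False

theorem RigVertex.countable_of {V : Type*} (A : Arena V) : Countable (RigVertex A) := by
  have := A.countable
  let f : RigVertex A → Fin 4 × V × V := fun x => match x with
    | .orig v => (0, v, v)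
    | .copy v _ => (1, v, v)
    | .dist v v' _ => (2, v, v')
    | .edge v v' _ _ => (3, v, v')
  refine Function.Injective.countable (f := f) ?_
  intro x y h
  cases x <;> cases y <;> simp_all [f]

/-- The rigged arena: Player 0 owns exactly the copies `v̄`, and there are no disturbance edges. -/
def Arena.rig {V : Type*} (A : Arena V) : Arena (RigVertex A) where
  countable := RigVertex.countable_of A
  V₀ := {x | ∃ v hv, x = .copy v hv}
  E := RigEdge A
  D := fun _ _ => False
  disturb_source := fun _ _ h => h.elim
  exists_succ := by
    intro x
    cases x with
    | orig v =>
      by_cases hv : v ∈ A.V₀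
      · exact ⟨_, .toCopy v hv⟩
      · obtain ⟨v', h⟩ := A.exists_succ v
        exact ⟨_, .toEdge v v' hv h⟩
    | copy v hv =>
      obtain ⟨v', h⟩ := A.exists_succ v
      exact ⟨_, .ofCopy v v' hv h⟩
    | dist v v' h => exact ⟨_, .ofDist v v' h⟩
    | edge v v' hv h => exact ⟨_, .ofEdge v v' hv h⟩

/-- The rigged winning condition: `v₀ v₁ v₂ ⋯` with `v₀ ∈ V` and `v₀ v₂ v₄ ⋯ ∈ W`. -/
def rigWin {V : Type*} (A : Arena V) (W : Set (ℕ → V)) : Set (ℕ → RigVertex A) :=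
  {ρ | ∃ u ∈ W, ∀ j, ρ (2 * j) = .orig (u j)}

/-- The set `R_{≥ k}` of sequences in which at least `k` disturbances are simulated. -/
def atLeastDist {V : Type*} (A : Arena V) (k : ℕ) : Set (ℕ → RigVertex A) :=
  {ρ | (k : ℕ∞) ≤ Set.encard {j | (ρ j).IsDist}}

/-- The rigged game `(A_rig, W_rig ∪ R_{≥ k})`. -/
def riggedGame {V : Type*} (A : Arena V) (W : Set (ℕ → V)) (k : ℕ) : Game (RigVertex A) where
  arena := A.rig
  win := rigWin A W ∪ atLeastDist A k

/-! ### Pushdown systems -/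

/-- Stack symbols including the bottom symbol `⊥`, which is represented by `none`. -/
abbrev StackSym (Γ : Type*) := Option Γ

/-- Transition relations, i.e. sets of transitions `(q, X, q', w)`. -/
abbrev TransRel (Q Γ : Type*) := Set (Q × StackSym Γ × Q × List (StackSym Γ))

/-- All words written have length at most two, and `⊥` is neither written nor deleted: a transition
reading `⊥` puts it back below a word over `Γ`, any other transition writes a word over `Γ`. -/
structure TransRel.Valid {Q Γ : Type*} (T : TransRel Q Γ) : Prop where
  length_le : ∀ q X q' w, (q, X, q', w) ∈ T → w.length ≤ 2
  bottom : ∀ q q' w, (q, none, q', w) ∈ T → ∃ u : List Γ, w = u.map some ++ [none]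
  symbol : ∀ q A q' w, (q, some A, q', w) ∈ T → ∃ u : List Γ, w = u.map some

/-- A pushdown system with states `Q` and stack alphabet `Γ`. -/
structure PDS (Q Γ : Type*) where
  trans : TransRel Q Γ
  init : Q
  trans_valid : trans.Valid
  deadlockFree : ∀ q X, ∃ q' w, (q, X, q', w) ∈ trans

/-- A configuration `(q, γ⊥)`; the field `stack` is the word `γ ∈ Γ*` above the bottom symbol. -/
@[ext]
structure Config (Q Γ : Type*) where
  state : Q
  stack : List Γ

/-- The full stack content, a word in `Γ*⊥`, with the top of the stack leftmost. -/
def Config.content {Q Γ : Type*} (c : Config Q Γ) : List (StackSym Γ) :=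
  c.stack.map some ++ [none]

/-- The stack height `|content| - 1`. -/
def Config.sh {Q Γ : Type*} (c : Config Q Γ) : ℕ := c.stack.length

theorem Config.sh_eq {Q Γ : Type*} (c : Config Q Γ) : c.sh = c.content.length - 1 := by
  simp [Config.sh, Config.content]

/-- The one-step relation on configurations: the topmost symbol `X` is replaced by `w`. -/
def TransRel.Step {Q Γ : Type*} (T : TransRel Q Γ) (c c' : Config Q Γ) : Prop :=
  ∃ X rest w, c.content = X :: rest ∧ (c.state, X, c'.state, w) ∈ T ∧ c'.content = w ++ rest

theorem PDS.exists_step {Q Γ : Type*} (P : PDS Q Γ) (c : Config Q Γ) :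
    ∃ c', P.trans.Step c c' := by
  obtain ⟨q, s⟩ := c
  cases s with
  | nil =>
    obtain ⟨q', w, h⟩ := P.deadlockFree q none
    obtain ⟨u, hu⟩ := P.trans_valid.bottom _ _ _ h
    exact ⟨⟨q', u⟩, none, [], w, by simp [Config.content], h, by simp [Config.content, hu]⟩
  | cons A s =>
    obtain ⟨q', w, h⟩ := P.deadlockFree q (some A)
    obtain ⟨u, hu⟩ := P.trans_valid.symbol _ _ _ _ h
    exact ⟨⟨q', u ++ s⟩, some A, s.map some ++ [none], w, by simp [Config.content], h,
      by simp [Config.content, hu]⟩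

theorem Config.countable_of {Q Γ : Type*} [Finite Q] [Finite Γ] : Countable (Config Q Γ) := by
  refine Function.Injective.countable (f := fun c : Config Q Γ => (c.state, c.stack)) ?_
  intro x y h
  simp only [Prod.mk.injEq] at h
  exact Config.ext h.1 h.2

/-- A pushdown safety game with disturbances: a pushdown system, the set `Q₀` of states of Player 0
(Player 1 owns the other states), a transition relation `Δ` for the disturbances, and a set `F` of
states to be avoided by Player 0. -/
structure PushdownSafetyGame (Q Γ : Type*) extends PDS Q Γ where
  Q₀ : Set Q
  Δ : TransRel Q Γ
  Δ_valid : Δ.Valid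
  Δ_source : ∀ q X q' w, (q, X, q', w) ∈ Δ → q ∈ Q₀
  F : Set Q

namespace PushdownSafetyGame

variable {Q Γ : Type*} [Finite Q] [Finite Γ]

/-- The induced pushdown arena. -/
def arena (G : PushdownSafetyGame Q Γ) : Arena (Config Q Γ) where
  countable := Config.countable_of
  V₀ := {c | c.state ∈ G.Q₀}
  E := G.trans.Step
  D := G.Δ.Step
  disturb_source := by
    rintro v v' ⟨X, rest, w, -, h, -⟩
    exact G.Δ_source _ _ _ _ h
  exists_succ := G.toPDS.exists_step

/-- The set of vertices induced by the states in `F`. -/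
def configsF (G : PushdownSafetyGame Q Γ) : Set (Config Q Γ) := {c | c.state ∈ G.F}

/-- The rigged game `G_k = (A_rig, Safety(F)_rig ∪ R_{≥ k})`. -/
def rigged (G : PushdownSafetyGame Q Γ) (k : ℕ) : Game (RigVertex G.arena) :=
  riggedGame G.arena (Safety G.configsF) k

/-- The initial vertex `v_I = (q_I, ⊥)`, as a vertex of the rigged arena. -/
def vI (G : PushdownSafetyGame Q Γ) : RigVertex G.arena := .orig ⟨G.init, []⟩

/-- `F` as a set of vertices of the rigged arena; it contains no auxiliary vertex. -/
def rigF (G : PushdownSafetyGame Q Γ) : Set (RigVertex G.arena) :=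
  {x | ∃ v ∈ G.configsF, x = .orig v}

/-- The stack height of a vertex of the rigged arena. For an auxiliary vertex `(v, v')` it is the
larger one of the two stack heights involved. -/
def rigSh (G : PushdownSafetyGame Q Γ) : RigVertex G.arena → ℕ
  | .orig v => v.sh
  | .copy v _ => v.sh
  | .dist v v' _ => max v.sh v'.sh
  | .edge v v' _ _ => max v.sh v'.sh

/-- A strategy graph `(V°, E°, μ_r, μ_d)` for the rigged game `G_k`. -/
structure StrategyGraph (G : PushdownSafetyGame Q Γ) (k : ℕ) where
  verts : Set (RigVertex G.arena)
  edges : Set (RigVertex G.arena × RigVertex G.arena)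
  /-- The rank `μ_r : V° → {0, …, k - 1}`. -/
  rankR : verts → Fin k
  /-- The rank `μ_d : V° → {0, …, |V°|}`. -/
  rankD : verts → ℕ
  rankD_le : ∀ v, (rankD v : ℕ∞) ≤ verts.encard
  edges_verts : ∀ v v', (v, v') ∈ edges → v ∈ verts ∧ v' ∈ verts
  edges_sub : ∀ v v', (v, v') ∈ edges → (G.rigged k).arena.E v v'
  init_mem : G.vI ∈ verts
  sh_le : ∀ v ∈ verts, G.rigSh v ≤ (2 * k) ^ (Nat.card Q ^ 2)
  player_zero : ∀ v ∈ (verts ∩ (G.rigged k).arena.owned 0) \ G.rigF,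
    ∀ v', (G.rigged k).arena.E v v' → (v, v') ∈ edges
  player_one : ∀ v ∈ (verts ∩ (G.rigged k).arena.owned 1) \ G.rigF,
    ∃! v', (G.rigged k).arena.E v v' ∧ (v, v') ∈ edges
  rankR_le : ∀ v v' : verts, (v.1, v'.1) ∈ edges → rankR v' ≤ rankR v
  rankR_lt : ∀ v v' : verts, (v.1, v'.1) ∈ edges → v.1.IsDist → rankR v' < rankR v
  rankD_lt : ∀ v v' : verts, (v.1, v'.1) ∈ edges → rankD v' < rankD v

end PushdownSafetyGame

/-! Player 1 wins exactly if, for some budget below `k`, he can force a visit to `F` while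
simulating at most that many disturbances. If no such budget exists, Player 0 can keep it that way
at each of her moves (`exists_force_of_winsFrom`). Forcing is an inductive predicate `Force`, so
minimal budgets and, for these, minimal numbers of rounds decrease along optimal play and yield the
ranks of a strategy graph (`Force.exists_rank`, `nonempty_strategyGraph`). Conversely, the ranks of
a strategy graph bound the time until `F` is visited and the number of disturbances on the way
(`StrategyGraph.winsFrom`).

What remains is the height bound. An excursion above a level matters only through the vertices where
it descends and the budget left there; `LevelForce` records this by thresholds `τ`. For excursions
starting at height 1 only finitely many triples (state, thresholds, budget) are relevant, so as the
ceiling grows, the set of solvable triples repeats at some small ceiling `N`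
(`exists_stableLevel_one`). One step without gain persists forever: above the bottom the counter is
translation invariant, so the repetition at `N` moves up one level (`StableLevel.shift`), and
stability at a level passes to the level below (`StableLevel.down`). Hence no ceiling above `N`
helps (`exists_stableLevel_zero`). -/

/-! ### Forcing with a budget -/

/-- `Force M R T v b`: starting in `v` with budget `b`, the target `T` can be forced by moves in the
region `R`, where `M v S c` says that one can move from `v` into the set `S` at cost `c`. -/
inductive Force {V : Type*} (M : V → Set V → ℕ → Prop) (R : Set V) (T : V → ℕ → Prop) :
    V → ℕ → Prop
  | base {v : V} {b : ℕ} : T v b → Force M R T v b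
  | step {v : V} {S : Set V} {c b : ℕ} : v ∈ R → M v S c → (∀ v' ∈ S, Force M R T v' b) →
      Force M R T v (b + c)

namespace Force

variable {V : Type*} {M : V → Set V → ℕ → Prop} {R R' : Set V} {T T' : V → ℕ → Prop}

theorem mono_budget (hT : ∀ v b b', b ≤ b' → T v b → T v b') {v : V} {b : ℕ}
    (h : Force M R T v b) : ∀ b', b ≤ b' → Force M R T v b' := by
  induction h with
  | base h => exact fun b' hb => .base (hT _ _ _ hb h)
  | @step v S c b hR hM _ ih =>
    intro b' hb
    obtain ⟨e, rfl⟩ := Nat.exists_eq_add_of_le hb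
    rw [show b + c + e = b + e + c by omega]
    exact .step hR hM fun v' hv' => ih v' hv' _ (Nat.le_add_right _ _)

/-- Strategies are concatenated at the leaves. Budgets never grow along a play, so only leaves with
budget below `k` have to be continued. -/
theorem bind {k : ℕ} (hR : R ⊆ R') (hT : ∀ v b, b < k → T v b → Force M R' T' v b) {v : V} {b : ℕ}
    (h : Force M R T v b) : b < k → Force M R' T' v b := by
  induction h with
  | base h => exact fun hb => hT _ _ hb h
  | step h1 h2 _ ih => exact fun hb => .step (hR h1) h2 fun v' hv' => ih v' hv' (by omega)

theorem exists_target (hM : ∀ v S c, M v S c → S.Nonempty) {v : V} {b : ℕ}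
    (h : Force M R T v b) : ∃ v b, T v b := by
  induction h with
  | base h => exact ⟨_, _, h⟩
  | step _ h2 _ ih =>
    obtain ⟨v', hv'⟩ := hM _ _ _ h2
    exact ih v' hv'

/-- Forcing within at most `n` rounds. -/
def Within (M : V → Set V → ℕ → Prop) (R : Set V) (T : V → ℕ → Prop) : ℕ → V → ℕ → Prop
  | 0, v, b => T v b
  | n + 1, v, b => T v b ∨ ∃ S c b', v ∈ R ∧ M v S c ∧ b = b' + c ∧ ∀ v' ∈ S, Within M R T n v' b'

theorem Within.succ : ∀ {n : ℕ} {v : V} {b : ℕ}, Within M R T n v b → Within M R T (n + 1) v b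
  | 0, _, _, h => Or.inl h
  | _ + 1, _, _, .inl h => Or.inl h
  | _ + 1, _, _, .inr ⟨S, c, b', hR, hM, hb, h⟩ =>
    Or.inr ⟨S, c, b', hR, hM, hb, fun v' hv' => (h v' hv').succ⟩

theorem Within.mono {n m : ℕ} (hnm : n ≤ m) {v : V} {b : ℕ} (h : Within M R T n v b) :
    Within M R T m v b := by
  induction hnm with
  | refl => exact h
  | step _ ih => exact ih.succ

theorem Within.force {n : ℕ} {v : V} {b : ℕ} (h : Within M R T n v b) : Force M R T v b := by
  induction n generalizing v b with
  | zero => exact .base h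
  | succ n ih =>
    rcases h with h | ⟨S, c, b', hR, hM, rfl, h⟩
    · exact .base h
    · exact .step hR hM fun v' hv' => ih (h v' hv')

/-- A family of properties that is monotone in its index holds uniformly on a finite set. -/
theorem _root_.Set.Finite.exists_uniform_nat {S : Set V} (hS : S.Finite) {p : ℕ → V → Prop}
    (hp : ∀ n m v, n ≤ m → p n v → p m v) (h : ∀ v ∈ S, ∃ n, p n v) : ∃ n, ∀ v ∈ S, p n v := by
  choose! f hf using h
  obtain ⟨n, hn⟩ := (hS.image f).bddAbove
  exact ⟨n, fun v hv => hp _ _ _ (hn (Set.mem_image_of_mem f hv)) (hf v hv)⟩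

/-- Each move has finitely many outcomes, so the bounds on the remaining rounds have a maximum. -/
theorem exists_within (hM : ∀ v S c, M v S c → S.Finite) {v : V} {b : ℕ}
    (h : Force M R T v b) : ∃ n, Within M R T n v b := by
  induction h with
  | base h => exact ⟨0, h⟩
  | step h1 h2 _ ih =>
    obtain ⟨n, hn⟩ := (hM _ _ _ h2).exists_uniform_nat (p := fun n v => Within M R T n v _)
      (fun _ _ _ h h' => Within.mono h h') ih
    exact ⟨n + 1, .inr ⟨_, _, _, h1, h2, rfl, hn⟩⟩

end Force

/-- Forcing to reach `F` at a height in `[l, H]`, or to descend below height `l` with a remaining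
budget of at least `τ v` in the vertex `v` reached, while visiting only heights in `[l, H]`. -/
def LevelForce {V : Type*} (M : V → Set V → ℕ → Prop) (sh : V → ℕ) (F : Set V) (l H : ℕ)
    (τ : V → ℕ) : V → ℕ → Prop :=
  Force M {v | l ≤ sh v ∧ sh v ≤ H}
    (fun v b => (v ∈ F ∧ l ≤ sh v ∧ sh v ≤ H) ∨ (sh v < l ∧ τ v ≤ b))

/-- With budgets below `k`, heights between `H` and `H'` do not help in vertices of height `l`. -/
def StableLevel {V : Type*} (M : V → Set V → ℕ → Prop) (sh : V → ℕ) (F : Set V) (k l H H' : ℕ) :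
    Prop :=
  ∀ τ v b, b < k → sh v = l → LevelForce M sh F l H' τ v b → LevelForce M sh F l H τ v b

/-! ### Excursions above a level and the effect of raising the ceiling. -/

section Level

variable {V : Type*} {M : V → Set V → ℕ → Prop} {sh : V → ℕ} {F : Set V}

theorem LevelForce.mono_budget {l H : ℕ} {τ : V → ℕ} {v : V} {b b' : ℕ} (hb : b ≤ b')
    (h : LevelForce M sh F l H τ v b) : LevelForce M sh F l H τ v b' := by
  refine Force.mono_budget (fun v b b' hb h => ?_) h b' hb
  exact h.imp id fun h => ⟨h.1, h.2.trans hb⟩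

theorem LevelForce.mono_height {l H H' : ℕ} (hH : H ≤ H') {τ : V → ℕ} {v : V} {b : ℕ}
    (h : LevelForce M sh F l H τ v b) : LevelForce M sh F l H' τ v b := by
  refine Force.bind (k := b + 1) ?_ (fun v b _ h => .base ?_) h (Nat.lt_succ_self b)
  · exact fun v hv => ⟨hv.1, hv.2.trans hH⟩
  · exact h.imp (fun h => ⟨h.1, h.2.1, h.2.2.trans hH⟩) id

theorem LevelForce.height_le {H : ℕ} {τ : V → ℕ} {v : V} {b : ℕ}
    (h : LevelForce M sh F 0 H τ v b) : sh v ≤ H := by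
  cases h with
  | base h => exact h.elim (fun h => h.2.2) fun h => absurd h.1 (Nat.not_lt_zero _)
  | step h _ _ => exact h.2

/-- Finite branching bounds the heights that a forcing strategy visits. The thresholds are arbitrary
because no vertex lies below level 0. -/
theorem LevelForce.of_force (hM : ∀ v S c, M v S c → S.Finite) {τ : V → ℕ} {v : V} {b : ℕ}
    (h : Force M Set.univ (fun v _ => v ∈ F) v b) : ∃ H, LevelForce M sh F 0 H τ v b := by
  induction h with
  | @base v b h => exact ⟨sh v, .base (.inl ⟨h, Nat.zero_le _, le_rfl⟩)⟩
  | @step v S c b _ h2 _ ih =>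
    obtain ⟨n, hn⟩ := (hM _ _ _ h2).exists_uniform_nat
      (p := fun H v => LevelForce M sh F 0 H τ v b) (fun _ _ _ h h' => LevelForce.mono_height h h') ih
    exact ⟨max n (sh v), .step ⟨Nat.zero_le _, le_max_right _ _⟩ h2
      fun v' hv' => (hn v' hv').mono_height (le_max_left _ _)⟩

/-- A play from level `l` splits into rounds at height `l` and excursions from height `l + 1`. Each
excursion can be replaced by one below `H` if the thresholds at its exits are the budgets needed to
go on from there. -/
theorem StableLevel.down (hM : ∀ v S c, M v S c → ∀ v' ∈ S, sh v' ≤ sh v + 1) {k l H H' : ℕ}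
    (hl : l ≤ H) (h : StableLevel M sh F k (l + 1) H H') : StableLevel M sh F k l H H' := by
  classical
  intro τ v b hb hv hF
  -- The price of an exit: the least budget that suffices below the ceiling `H`. The value `k`
  -- stands for infinity, since only budgets below `k` occur.
  let τ' : V → ℕ := fun v => if h : ∃ b, LevelForce M sh F l H τ v b then Nat.find h else k
  have le_τ' : ∀ v b, LevelForce M sh F l H τ v b → τ' v ≤ b := fun v b h => by
    have h' : ∃ b, LevelForce M sh F l H τ v b := ⟨b, h⟩
    simpa only [τ', dif_pos h'] using Nat.find_min' h' h
  have of_τ' : ∀ v b, b < k → τ' v ≤ b → LevelForce M sh F l H τ v b := fun v b hb h => by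
    by_cases h' : ∃ b, LevelForce M sh F l H τ v b
    · simp only [τ', dif_pos h'] at h
      exact (Nat.find_spec h').mono_budget h
    · simp only [τ', dif_neg h'] at h
      omega
  -- Above `l` the vertex lies inside an excursion, so there the induction only yields forcing up to
  -- the exits, still with ceiling `H'`.
  suffices key : (sh v ≤ l → LevelForce M sh F l H τ v b) ∧
      (l < sh v → LevelForce M sh F (l + 1) H' τ' v b) from key.1 hv.le
  clear hv
  induction hF with
  | base hT =>
    rcases hT with hT | hT
    · exact ⟨fun h => .base (.inl ⟨hT.1, hT.2.1, h.trans hl⟩),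
        fun h => .base (.inl ⟨hT.1, h, hT.2.2⟩)⟩
    · exact ⟨fun _ => .base (.inr hT), fun h => absurd h hT.1.not_gt⟩
  | @step v S c b hR hMv _ ih =>
    have hb' : b < k := by omega
    refine ⟨fun hv => .step ⟨hR.1, hv.trans hl⟩ hMv fun v' hv' => ?_,
      fun hv => .step ⟨hv, hR.2⟩ hMv fun v' hv' => ?_⟩
    · obtain ⟨ih1, ih2⟩ := ih v' hv' hb'
      by_cases hv1 : sh v' ≤ l
      · exact ih1 hv1
      -- A round climbs by at most one, so the excursion starts exactly at height `l + 1`, where `h`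
      -- lowers its ceiling.
      · have hs := hM _ _ _ hMv v' hv'
        refine Force.bind (k := k) ?_ ?_ (h τ' v' b hb' (by omega) (ih2 (by omega))) hb'
        · exact fun v hv => ⟨(Nat.le_succ l).trans hv.1, hv.2⟩
        rintro u e he (hu | hu)
        · exact .base (.inl ⟨hu.1, (Nat.le_succ l).trans hu.2.1, hu.2.2⟩)
        · exact of_τ' u e he hu.2
    · obtain ⟨ih1, ih2⟩ := ih v' hv' hb'
      by_cases hv1 : sh v' ≤ l
      · exact .base (.inr ⟨Nat.lt_succ_of_le hv1, le_τ' _ _ (ih1 hv1)⟩)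
      · exact ih2 (by omega)

/-- From heights at least 1, `push` commutes with moves, so the whole situation can be translated by
one level, with the thresholds pulled back along `push`. Hence the condition `1 ≤ l`. -/
theorem StableLevel.shift {push : V → V} (hsh : ∀ v, sh (push v) = sh v + 1)
    (hF : ∀ v, push v ∈ F ↔ v ∈ F) (hsurj : ∀ v, 1 ≤ sh v → ∃ u, v = push u)
    (hM : ∀ v S c, 1 ≤ sh v → (M (push v) S c ↔ ∃ S₀, M v S₀ c ∧ S = push '' S₀)) {k l H H' : ℕ}
    (hl : 1 ≤ l) (h : StableLevel M sh F k l H H') :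
    StableLevel M sh F k (l + 1) (H + 1) (H' + 1) := by
  intro τ v b hb hv hv'
  obtain ⟨u, rfl⟩ := hsurj v (by omega)
  have lower : ∀ {v b}, LevelForce M sh F (l + 1) (H' + 1) τ v b → ∀ u, v = push u →
      LevelForce M sh F l H' (τ ∘ push) u b := by
    intro v b h
    induction h with
    | base hT =>
      rintro u rfl
      rw [hF, hsh] at hT
      exact .base (hT.imp (fun h => ⟨h.1, by omega⟩) fun h => ⟨by omega, h.2⟩)
    | step hR hMv _ ih =>
      rintro u rfl
      simp only [Set.mem_ofPred_eq, hsh] at hR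
      obtain ⟨S₀, hS, rfl⟩ := (hM _ _ _ (by omega)).1 hMv
      exact .step ⟨by omega, by omega⟩ hS fun v' hv' => ih _ (Set.mem_image_of_mem _ hv') v' rfl
  have raise : ∀ {u b}, LevelForce M sh F l H (τ ∘ push) u b →
      LevelForce M sh F (l + 1) (H + 1) τ (push u) b := by
    intro u b h
    induction h with
    | base hT =>
      refine .base ?_
      rw [hF, hsh]
      exact hT.imp (fun h => ⟨h.1, by omega⟩) fun h => ⟨by omega, h.2⟩
    | @step u S c b hR hMv _ ih =>
      refine .step (S := push '' S) ?_ ((hM _ _ _ (hl.trans hR.1)).2 ⟨S, hMv, rfl⟩) ?_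
      · simp only [Set.mem_ofPred_eq, hsh]
        exact ⟨Nat.succ_le_succ hR.1, Nat.succ_le_succ hR.2⟩
      · rintro _ ⟨v', hv', rfl⟩
        exact ih v' hv'
  exact raise (h _ _ _ hb (by rw [hsh] at hv; omega) (lower hv' u rfl))

theorem StableLevel.trans {k l H H' H'' : ℕ} (h : StableLevel M sh F k l H H')
    (h' : StableLevel M sh F k l H' H'') : StableLevel M sh F k l H H'' :=
  fun τ v b hb hv hF => h τ v b hb hv (h' τ v b hb hv hF)

end Level

/-- An increasing sequence of subsets of a finite type has a repetition early on. -/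
theorem exists_eq_succ_of_monotone {α : Type*} [Finite α] {f : ℕ → Set α} (hf : Monotone f) :
    ∃ i ≤ Nat.card α, f i = f (i + 1) := by
  by_contra! h
  have key : ∀ i ≤ Nat.card α + 1, i ≤ (f i).ncard := by
    intro i
    induction i with
    | zero => exact fun _ => Nat.zero_le _
    | succ i ih =>
      intro hi
      have h1 := ih (by omega)
      have h2 : (f i).ncard < (f (i + 1)).ncard :=
        Set.ncard_lt_ncard ((hf (Nat.le_succ i)).lt_of_ne (h i (by omega))) (Set.toFinite _)
      omega
  have h1 := key _ le_rfl
  have h2 : (f (Nat.card α + 1)).ncard ≤ Nat.card α := by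
    rw [← Set.ncard_univ]
    exact Set.ncard_le_ncard (Set.subset_univ _)
  omega

/-! ### Rounds of the rigged game -/

/-- The number of disturbances simulated by a vertex of the rigged arena. -/
def RigVertex.cost {V : Type*} {A : Arena V} : RigVertex A → ℕ
  | .dist _ _ _ => 1
  | _ => 0

/-- In one round of the rigged game, Player 1 can move from `v` into `S` with `c` disturbances. -/
def Arena.Move {V : Type*} (A : Arena V) (v : V) (S : Set V) (c : ℕ) : Prop :=
  ∃ x, RigEdge A (.orig v) x ∧ S = {v' | RigEdge A x (.orig v')} ∧ c = x.cost

section Rig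

variable {V : Type*} {A : Arena V}

theorem rigEdge_dist_iff {v v' : V} {h : A.D v v'} {y : RigVertex A} :
    RigEdge A (.dist v v' h) y ↔ y = .orig v' :=
  ⟨fun h => by cases h; rfl, by rintro rfl; exact .ofDist _ _ _⟩

theorem rigEdge_edge_iff {v v' : V} {hv : v ∉ A.V₀} {h : A.E v v'} {y : RigVertex A} :
    RigEdge A (.edge v v' hv h) y ↔ y = .orig v' :=
  ⟨fun h => by cases h; rfl, by rintro rfl; exact .ofEdge _ _ _ _⟩

theorem rigEdge_copy_iff {v : V} {hv : v ∈ A.V₀} {y : RigVertex A} :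
    RigEdge A (.copy v hv) y ↔ ∃ v', A.E v v' ∧ y = .orig v' :=
  ⟨fun h => by cases h with | ofCopy _ v' _ h => exact ⟨v', h, rfl⟩,
    by rintro ⟨v', h, rfl⟩; exact .ofCopy _ _ _ h⟩

theorem Arena.move_iff {v : V} {S : Set V} {c : ℕ} : A.Move v S c ↔
    (∃ v', A.D v v' ∧ S = {v'} ∧ c = 1) ∨ (v ∈ A.V₀ ∧ S = {v' | A.E v v'} ∧ c = 0) ∨
      (v ∉ A.V₀ ∧ ∃ v', A.E v v' ∧ S = {v'} ∧ c = 0) := by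
  constructor
  · rintro ⟨x, hx, rfl, rfl⟩
    cases hx with
    | toDist _ v' h => exact .inl ⟨v', h, by ext; simp [rigEdge_dist_iff], rfl⟩
    | toCopy _ hv => exact .inr (.inl ⟨hv, by ext; simp [rigEdge_copy_iff], rfl⟩)
    | toEdge _ v' hv h => exact .inr (.inr ⟨hv, v', h, by ext; simp [rigEdge_edge_iff], rfl⟩)
  · rintro (⟨v', h, rfl, rfl⟩ | ⟨hv, rfl, rfl⟩ | ⟨hv, v', h, rfl, rfl⟩)
    · exact ⟨_, .toDist v v' h, by ext; simp [rigEdge_dist_iff], rfl⟩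
    · exact ⟨_, .toCopy v hv, by ext; simp [rigEdge_copy_iff], rfl⟩
    · exact ⟨_, .toEdge v v' hv h, by ext; simp [rigEdge_edge_iff], rfl⟩

theorem Arena.Move.edge_or_disturb {v : V} {S : Set V} {c : ℕ} (h : A.Move v S c) {v' : V}
    (hv' : v' ∈ S) : A.E v v' ∨ A.D v v' := by
  rcases Arena.move_iff.1 h with ⟨w, hw, rfl, -⟩ | ⟨-, rfl, -⟩ | ⟨-, w, hw, rfl, -⟩
  · rw [Set.mem_singleton_iff.1 hv']
    exact .inr hw
  · exact .inl hv'
  · rw [Set.mem_singleton_iff.1 hv']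
    exact .inl hw

theorem Arena.Move.nonempty {v : V} {S : Set V} {c : ℕ} (h : A.Move v S c) : S.Nonempty := by
  rcases Arena.move_iff.1 h with ⟨w, h, rfl, -⟩ | ⟨-, rfl, -⟩ | ⟨-, w, h, rfl, -⟩
  · exact Set.singleton_nonempty _
  · exact A.exists_succ v
  · exact Set.singleton_nonempty _

end Rig

/-! ### Steps of one-counter systems -/

/-- Put the symbol `a` directly above the bottom of the stack. -/
def Config.raise {Q Γ : Type*} (a : Γ) (c : Config Q Γ) : Config Q Γ := ⟨c.state, c.stack ++ [a]⟩

section Step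

variable {Q Γ : Type*}

theorem TransRel.Valid.step_cons_iff {T : TransRel Q Γ} (hT : T.Valid) {q : Q} {a : Γ} {s : List Γ}
    {c : Config Q Γ} : T.Step ⟨q, a :: s⟩ c ↔
      ∃ u : List Γ, (q, some a, c.state, u.map some) ∈ T ∧ c.stack = u ++ s := by
  have inj : Function.Injective (List.map (some : Γ → Option Γ)) :=
    List.map_injective_iff.2 (Option.some_injective _)
  constructor
  · rintro ⟨X, rest, w, h1, h2, h3⟩
    simp only [Config.content, List.map_cons, List.cons_append, List.cons.injEq] at h1
    obtain ⟨rfl, rfl⟩ := h1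
    obtain ⟨u, rfl⟩ := hT.symbol _ _ _ _ h2
    refine ⟨u, h2, inj ?_⟩
    rw [Config.content, ← List.append_assoc] at h3
    simpa using List.append_cancel_right h3
  · rintro ⟨u, h1, h2⟩
    exact ⟨some a, s.map some ++ [none], u.map some, by simp [Config.content], h1,
      by simp [Config.content, h2]⟩

theorem TransRel.Valid.step_raise_iff {T : TransRel Q Γ} (hT : T.Valid) (a : Γ) {c d : Config Q Γ}
    (hc : 1 ≤ c.sh) : T.Step (c.raise a) d ↔ ∃ e, T.Step c e ∧ d = e.raise a := by
  obtain ⟨q, s⟩ := c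
  obtain ⟨q', t⟩ := d
  cases s with
  | nil => simp [Config.sh] at hc
  | cons x s =>
    simp only [Config.raise, List.cons_append, hT.step_cons_iff]
    constructor
    · rintro ⟨u, h1, h2⟩
      exact ⟨⟨q', u ++ s⟩, ⟨u, h1, rfl⟩, by simp_all⟩
    · rintro ⟨⟨q'', t'⟩, ⟨u, h1, h2⟩, h3⟩
      simp only [Config.mk.injEq] at h3 h2
      obtain ⟨rfl, rfl⟩ := h3
      exact ⟨u, h1, by simp [h2]⟩

theorem TransRel.Valid.sh_le {T : TransRel Q Γ} (hT : T.Valid) {c d : Config Q Γ}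
    (h : T.Step c d) : d.sh ≤ c.sh + 1 := by
  obtain ⟨X, rest, w, h1, h2, h3⟩ := h
  have hw := hT.length_le _ _ _ _ h2
  have h4 := congrArg List.length h1
  have h5 := congrArg List.length h3
  simp only [Config.content, List.length_append, List.length_map, List.length_cons,
    List.length_nil] at h4 h5
  simp only [Config.sh]
  omega

theorem Config.finite_sh_le [Finite Q] [Finite Γ] (n : ℕ) : {c : Config Q Γ | c.sh ≤ n}.Finite := by
  refine Set.Finite.of_finite_image (f := fun c => (c.state, c.stack))
    ((Set.finite_univ.prod (List.finite_length_le Γ n)).subset ?_)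
    fun c _ d _ h => Config.ext (Prod.ext_iff.1 h).1 (Prod.ext_iff.1 h).2
  rintro _ ⟨c, hc, rfl⟩
  exact ⟨trivial, hc⟩

end Step

/-! ### The height bound for one-counter systems. -/

namespace PushdownSafetyGame

variable {Q Γ : Type*} [Finite Q] [Finite Γ] (G : PushdownSafetyGame Q Γ)

theorem move_sh_le {v : Config Q Γ} {S : Set (Config Q Γ)} {c : ℕ} (h : G.arena.Move v S c)
    {v' : Config Q Γ} (hv' : v' ∈ S) : v'.sh ≤ v.sh + 1 :=
  (h.edge_or_disturb hv').elim G.trans_valid.sh_le G.Δ_valid.sh_le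

theorem move_finite {v : Config Q Γ} {S : Set (Config Q Γ)} {c : ℕ} (h : G.arena.Move v S c) :
    S.Finite :=
  (Config.finite_sh_le (v.sh + 1)).subset fun _ hv' => G.move_sh_le h hv'

/-- A nonempty stack hides what lies beneath its top symbol, so a letter inserted above the bottom
does not affect the round. -/
theorem move_raise_iff (a : Γ) {v : Config Q Γ} {S : Set (Config Q Γ)} {c : ℕ} (hv : 1 ≤ v.sh) :
    G.arena.Move (v.raise a) S c ↔ ∃ S₀, G.arena.Move v S₀ c ∧ S = Config.raise a '' S₀ := by
  have hE : ∀ d, G.arena.E (v.raise a) d ↔ ∃ e, G.arena.E v e ∧ d = e.raise a :=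
    fun d => G.trans_valid.step_raise_iff a hv
  have hD : ∀ d, G.arena.D (v.raise a) d ↔ ∃ e, G.arena.D v e ∧ d = e.raise a :=
    fun d => G.Δ_valid.step_raise_iff a hv
  have h0 : v.raise a ∈ G.arena.V₀ ↔ v ∈ G.arena.V₀ := Iff.rfl
  have hS : {v' | G.arena.E (v.raise a) v'} = Config.raise a '' {v' | G.arena.E v v'} := by
    ext d
    simp only [Set.mem_ofPred_eq, hE, Set.mem_image, eq_comm]
  simp only [Arena.move_iff, h0, hS]
  constructor
  · rintro (⟨v', h, rfl, rfl⟩ | ⟨hv, rfl, rfl⟩ | ⟨hv, v', h, rfl, rfl⟩)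
    · obtain ⟨e, he, rfl⟩ := (hD _).1 h
      exact ⟨{e}, .inl ⟨e, he, rfl, rfl⟩, Set.image_singleton.symm⟩
    · exact ⟨_, .inr (.inl ⟨hv, rfl, rfl⟩), rfl⟩
    · obtain ⟨e, he, rfl⟩ := (hE _).1 h
      exact ⟨{e}, .inr (.inr ⟨hv, e, he, rfl, rfl⟩), Set.image_singleton.symm⟩
  · rintro ⟨_, ⟨v', h, rfl, rfl⟩ | ⟨hv, rfl, rfl⟩ | ⟨hv, v', h, rfl, rfl⟩, rfl⟩
    · exact .inl ⟨_, (hD _).2 ⟨v', h, rfl⟩, Set.image_singleton, rfl⟩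
    · exact .inr (.inl ⟨hv, rfl, rfl⟩)
    · exact .inr (.inr ⟨hv, _, (hE _).2 ⟨v', h, rfl⟩, Set.image_singleton, rfl⟩)

theorem exists_stableLevel_one (hΓ : Nat.card Γ = 1) (k : ℕ) :
    ∃ N, 1 ≤ N ∧ N ≤ Nat.card Q * ((k + 1) ^ Nat.card Q * k) + 1 ∧
      StableLevel G.arena.Move Config.sh G.configsF k 1 N (N + 1) := by
  obtain ⟨_, ⟨a⟩⟩ := Nat.card_eq_one_iff_unique.1 hΓ
  -- Exits below level 1 have an empty stack, so thresholds are functions of the state. The number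
  -- of triples gives the bound on the repetition index `i`; the final `+ 1` is the offset of the
  -- ceiling `i + 1`.
  let f : ℕ → Set (Q × (Q → Fin (k + 1)) × Fin k) := fun i => {p |
    LevelForce G.arena.Move Config.sh G.configsF 1 (i + 1) (fun v => p.2.1 v.state) ⟨p.1, [a]⟩ p.2.2}
  have hf : Monotone f := fun i j hij p hp => LevelForce.mono_height (Nat.succ_le_succ hij) hp
  obtain ⟨i, hi, hfi⟩ := exists_eq_succ_of_monotone hf
  refine ⟨i + 1, Nat.le_add_left _ _, ?_, ?_⟩
  · simpa [Nat.card_prod, Nat.card_fun] using hi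
  · rintro τ ⟨q, s⟩ b hb hv hF
    obtain ⟨x, rfl⟩ := List.length_eq_one_iff.1 hv
    obtain rfl : x = a := Subsingleton.elim _ _
    -- Thresholds may be cut off at `k`, which no budget below `k` can meet.
    let τ₀ : Q → Fin (k + 1) := fun q => ⟨min (τ ⟨q, []⟩) k, by omega⟩
    have hbot : ∀ v : Config Q Γ, v.sh < 1 → (τ₀ v.state : ℕ) = min (τ v) k := by
      rintro ⟨q, s⟩ hv
      obtain rfl : s = [] := List.length_eq_zero_iff.1 (Nat.lt_one_iff.1 hv)
      rfl
    have h1 : (q, τ₀, (⟨b, hb⟩ : Fin k)) ∈ f (i + 1) := by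
      refine Force.bind (k := k) subset_rfl (fun v e he h => .base ?_) hF hb
      exact h.imp id fun h => ⟨h.1, (hbot v h.1).le.trans ((min_le_left _ _).trans h.2)⟩
    rw [← hfi] at h1
    refine Force.bind (k := k) subset_rfl (fun v e he h => .base ?_) h1 hb
    refine h.imp id fun h => ⟨h.1, ?_⟩
    have := (hbot v h.1).ge.trans h.2
    omega

theorem exists_stableLevel_zero (hΓ : Nat.card Γ = 1) (k : ℕ) :
    ∃ N, N ≤ Nat.card Q * ((k + 1) ^ Nat.card Q * k) + 1 ∧
      ∀ H, StableLevel G.arena.Move Config.sh G.configsF k 0 N H := by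
  obtain ⟨N, h1, hN, hst⟩ := G.exists_stableLevel_one hΓ k
  obtain ⟨_, ⟨a⟩⟩ := Nat.card_eq_one_iff_unique.1 hΓ
  have hM : ∀ (v : Config Q Γ) S c, G.arena.Move v S c → ∀ v' ∈ S, v'.sh ≤ v.sh + 1 :=
    fun v S c h v' hv' => G.move_sh_le h hv'
  have succ : ∀ i, StableLevel G.arena.Move Config.sh G.configsF k 1 (N + i) (N + i + 1) := by
    intro i
    induction i with
    | zero => exact hst
    | succ i ih =>
      -- Shifting to level 2 raises both ceilings by one; descending to level 1 keeps them.
      refine StableLevel.down hM (by omega) (StableLevel.shift (push := Config.raise a)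
        (fun v => by simp [Config.sh, Config.raise]) (fun v => Iff.rfl) ?_
        (fun v S c hv => G.move_raise_iff a hv) le_rfl ih)
      -- With a single letter, every nonempty stack arises by inserting that letter above the
      -- bottom.
      rintro ⟨q, s⟩ hs
      obtain ⟨t, x, rfl⟩ := List.eq_nil_or_concat' s |>.resolve_left
        (by rintro rfl; simp [Config.sh] at hs)
      exact ⟨⟨q, t⟩, by simp [Config.raise, Subsingleton.elim x a]⟩
  have all : ∀ i, StableLevel G.arena.Move Config.sh G.configsF k 1 N (N + i) := by
    intro i
    induction i with
    | zero => exact fun τ v b _ _ h => h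
    | succ i ih => exact ih.trans (succ i)
  refine ⟨N, hN, fun H => ?_⟩
  refine StableLevel.down hM (Nat.zero_le _) fun τ v b hb hv h => all H τ v b hb hv ?_
  exact LevelForce.mono_height (Nat.le_add_left _ _) h

/-- Both `n * k + 1` and `(k + 1) ^ n` are at most `(2 * k) ^ n`, and `2 ≤ n` gives `n * 2 ≤ n ^ 2`.
-/
theorem card_bound {n k : ℕ} (hn : 2 ≤ n) (hk : 1 ≤ k) :
    n * ((k + 1) ^ n * k) + 1 ≤ (2 * k) ^ (n ^ 2) := by
  have h1 : (k + 1) ^ n ≤ (2 * k) ^ n := Nat.pow_le_pow_left (by omega) n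
  have h2 : n * k + 1 ≤ (2 * k) ^ n := by
    have h3 : n + 1 ≤ 2 ^ n := Nat.lt_two_pow_self
    have h4 : k ≤ k ^ n := Nat.le_self_pow (by omega) k
    calc n * k + 1 ≤ (n + 1) * k := by nlinarith
      _ ≤ 2 ^ n * k ^ n := Nat.mul_le_mul h3 h4
      _ = (2 * k) ^ n := (mul_pow 2 k n).symm
  have h5 : 1 ≤ (2 * k) ^ n := Nat.one_le_pow _ _ (by omega)
  calc n * ((k + 1) ^ n * k) + 1 ≤ (n * k + 1) * (2 * k) ^ n := by
        nlinarith [Nat.mul_le_mul_left (n * k) h1]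
    _ ≤ (2 * k) ^ n * (2 * k) ^ n := Nat.mul_le_mul_right _ h2
    _ = (2 * k) ^ (n * 2) := by rw [pow_mul, sq, mul_pow]
    _ ≤ (2 * k) ^ (n ^ 2) := Nat.pow_le_pow_right (by omega) (by nlinarith)

/-- If Player 1 can force a visit to `F` with fewer than `k` disturbances, then he can do so below
the height bound of strategy graphs. -/
theorem exists_levelForce (hΓ : Nat.card Γ = 1) {k b : ℕ} (hb : b < k) (τ : Config Q Γ → ℕ)
    (h : Force G.arena.Move Set.univ (fun v _ => v ∈ G.configsF) ⟨G.init, []⟩ b) :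
    LevelForce G.arena.Move Config.sh G.configsF 0 ((2 * k) ^ (Nat.card Q ^ 2)) τ
      ⟨G.init, []⟩ b := by
  obtain ⟨v, -, hv⟩ := h.exists_target fun _ _ _ => Arena.Move.nonempty
  have : Nonempty Q := ⟨G.init⟩
  by_cases hQ : 2 ≤ Nat.card Q
  · obtain ⟨H, hH⟩ := LevelForce.of_force (sh := Config.sh) (τ := τ) (fun _ _ _ => G.move_finite) h
    obtain ⟨N, hN, hst⟩ := G.exists_stableLevel_zero hΓ k
    exact (hst H τ _ b hb rfl hH).mono_height (hN.trans (card_bound hQ (by omega)))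
  -- For a single state the estimate fails, but then the state of the forced target is the initial
  -- one, and no move is needed.
  · have hpos := Nat.card_pos (α := Q)
    have : Subsingleton Q := (Nat.card_eq_one_iff_unique.1 (by omega)).1
    have hI : G.init ∈ G.F := Subsingleton.elim v.state G.init ▸ hv
    exact .base (.inl ⟨hI, Nat.zero_le _, Nat.zero_le _⟩)

end PushdownSafetyGame

/-! ### From winning strategies to forcing -/

section Play

variable {V : Type*}

theorem Arena.exists_play (A : Arena V) {f : List V → V → V} (hf : ∀ w v, A.E v (f w v)) (v : V) :
    ∃ ρ : Play A, ρ.vertex 0 = v ∧ ρ.disturbances = 0 ∧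
      ∀ j, ρ.vertex (j + 1) = f ((List.range j).map ρ.vertex) (ρ.vertex j) := by
  let h : ℕ → List V × V := fun n => Nat.rec ([], v) (fun _ p => (p.1 ++ [p.2], f p.1 p.2)) n
  have hist : ∀ j, (h j).1 = (List.range j).map fun i => (h i).2 := by
    intro j
    induction j with
    | zero => rfl
    | succ j ih =>
      rw [List.range_succ, List.map_append, ← ih]
      rfl
  refine ⟨⟨fun j => (h j).2, fun _ => false, rfl, fun j _ => hf (h j).1 (h j).2, ?_⟩, rfl, ?_, ?_⟩
  · simp
  · simp [Play.disturbances]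
  · intro j
    rw [← hist]

theorem Arena.mem_owned_one {A : Arena V} {v : V} : v ∈ A.owned 1 ↔ v ∉ A.V₀ := by
  simp [Arena.owned]

variable {A : Arena V}

theorem Play.rigEdge (ρ : Play A.rig) (j : ℕ) : RigEdge A (ρ.vertex j) (ρ.vertex (j + 1)) := by
  refine ρ.standard j ?_
  by_contra h
  exact ρ.disturbed j (by simpa using h)

theorem Play.bit_eq_false (ρ : Play A.rig) (j : ℕ) : ρ.bit (j + 1) = false := by
  by_contra h
  exact ρ.disturbed j (by simpa using h)

theorem RigVertex.sum_cost_eq_card (ρ : ℕ → RigVertex A) (n : ℕ)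
    [DecidablePred (RigVertex.IsDist (A := A))] :
    ∑ i ∈ Finset.range n, (ρ i).cost = ((Finset.range n).filter fun i => (ρ i).IsDist).card := by
  rw [Finset.card_filter]
  refine Finset.sum_congr rfl fun i _ => ?_
  cases ρ i <;> simp [RigVertex.cost, RigVertex.IsDist]

theorem RigVertex.sum_map_cost (ρ : ℕ → RigVertex A) (n : ℕ) :
    (((List.range n).map ρ).map RigVertex.cost).sum = ∑ i ∈ Finset.range n, (ρ i).cost := by
  induction n with
  | zero => rfl
  | succ n ih => rw [List.range_succ, Finset.sum_range_succ, ← ih]; simp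

theorem mem_atLeastDist_of_le_sum {k n : ℕ} {ρ : ℕ → RigVertex A}
    (h : k ≤ ∑ i ∈ Finset.range n, (ρ i).cost) : ρ ∈ atLeastDist A k := by
  classical
  rw [RigVertex.sum_cost_eq_card] at h
  refine (Nat.cast_le (α := ℕ∞).2 h).trans ?_
  rw [← Set.encard_coe_eq_coe_finsetCard]
  refine Set.encard_le_encard fun i hi => ?_
  simpa using (Finset.mem_filter.1 hi).2

theorem not_mem_atLeastDist_of_sum_lt {k n : ℕ} {ρ : ℕ → RigVertex A}
    (h : ∑ i ∈ Finset.range n, (ρ i).cost < k) (hρ : ∀ j, n ≤ j → ¬ (ρ j).IsDist) :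
    ρ ∉ atLeastDist A k := by
  classical
  intro hk
  have hk : (k : ℕ∞) ≤ {j | (ρ j).IsDist}.encard := hk
  rw [RigVertex.sum_cost_eq_card] at h
  refine h.not_ge (Nat.cast_le.1 (hk.trans ?_))
  rw [← Set.encard_coe_eq_coe_finsetCard]
  refine Set.encard_le_encard fun i hi => ?_
  have : i < n := lt_of_not_ge fun h => hρ i h hi
  simpa [this] using hi

theorem RigEdge.eq_of_not_mem {x y y' : RigVertex A} (hx : x ∉ A.rig.V₀) (hx' : ∀ v, x ≠ .orig v)
    (h : RigEdge A x y) (h' : RigEdge A x y') : y = y' := by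
  cases x with
  | orig v => exact absurd rfl (hx' v)
  | copy v hv => exact absurd ⟨v, hv, rfl⟩ hx
  | dist => rw [rigEdge_dist_iff] at h h'; rw [h, h']
  | edge => rw [rigEdge_edge_iff] at h h'; rw [h, h']

theorem RigEdge.exists_orig {x y : RigVertex A} (hx : ∀ v, x ≠ .orig v) (h : RigEdge A x y) :
    ∃ v, y = .orig v := by
  cases h with
  | toDist | toCopy | toEdge => exact absurd rfl (hx _)
  | ofDist | ofCopy | ofEdge => exact ⟨_, rfl⟩

theorem RigEdge.ne_orig {v : V} {x : RigVertex A} (h : RigEdge A (.orig v) x) (u : V) :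
    x ≠ .orig u := by
  cases h <;> simp

theorem exists_force_of_winsFrom (F : Set V) (k : ℕ) {v : V}
    (h : (riggedGame A (Safety F) k).WinsFrom 1 (.orig v)) :
    ∃ b < k, Force A.Move Set.univ (fun v _ => v ∈ F) v b := by
  classical
  obtain ⟨σ, hσ⟩ := h
  by_contra! hno
  -- Here `n` counts the disturbances simulated so far. For `n ≥ k` the condition is vacuous, as
  -- Player 0 has already won.
  let Good : V → ℕ → Prop := fun v n => ∀ b, b + n < k →
    ¬ Force A.Move Set.univ (fun v _ => v ∈ F) v b
  have mono : ∀ {v b b'}, b ≤ b' → Force A.Move Set.univ (fun v _ => v ∈ F) v b →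
      Force A.Move Set.univ (fun v _ => v ∈ F) v b' :=
    fun hb h => h.mono_budget (fun _ _ _ _ h => h) _ hb
  have copy : ∀ (u : V) (hu : u ∈ A.V₀) n, Good u n → ∃ v', A.E u v' ∧ Good v' n := by
    intro u hu n hn
    by_cases hnk : n < k
    · by_contra! hall
      -- `B` is the largest budget still excluded at `u`. If every successor were losing for Player
      -- 0, budget `B` would suffice at all of them, hence at `u`.
      obtain ⟨B, rfl⟩ : ∃ B, k = B + n + 1 := ⟨k - 1 - n, by omega⟩
      refine hn B (by omega) (.step (c := 0) trivial ⟨_, .toCopy u hu, rfl, rfl⟩ ?_)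
      intro v' hv'
      obtain ⟨w, hw, hw'⟩ := rigEdge_copy_iff.1 hv'
      obtain rfl : v' = w := by simpa using hw'
      have := hall v' hw
      simp only [Good, not_forall, not_not] at this
      obtain ⟨b, hb, hf⟩ := this
      exact mono (by omega) hf
    · obtain ⟨v', hv'⟩ := A.exists_succ u
      exact ⟨v', hv', fun b hb => by omega⟩
  have other : ∀ {v x v' n}, Good v n → RigEdge A (.orig v) x → x ∉ A.rig.V₀ →
      RigEdge A x (.orig v') → Good v' (n + x.cost) := by
    intro v x v' n hn hvx hx hxv' b hb hf
    refine hn (b + x.cost) (by omega) (.step trivial ⟨x, hvx, rfl, rfl⟩ fun w hw => ?_)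
    obtain rfl : v' = w := by simpa using hxv'.eq_of_not_mem hx hvx.ne_orig hw
    exact hf
  -- The count is read off from the history; the current vertex, a copy, contributes nothing to it.
  have pick : ∀ (w : List (RigVertex A)) (x : RigVertex A), ∃ y, RigEdge A x y ∧
      ∀ u hu, x = .copy u hu → Good u (w.map RigVertex.cost).sum →
        ∃ v', y = .orig v' ∧ Good v' (w.map RigVertex.cost).sum := by
    intro w x
    by_cases hx : ∃ u hu, x = .copy u hu ∧ Good u (w.map RigVertex.cost).sum
    · obtain ⟨u, hu, rfl, hg⟩ := hx
      obtain ⟨v', hv', hg'⟩ := copy u hu _ hg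
      exact ⟨_, .ofCopy u v' hu hv', fun _ _ _ _ => ⟨v', rfl, hg'⟩⟩
    · obtain ⟨y, hy⟩ := A.rig.exists_succ x
      exact ⟨y, hy, fun u hu h h' => absurd ⟨u, hu, h, h'⟩ hx⟩
  choose p hp1 hp2 using pick
  obtain ⟨ρ, h0, hd, hρ⟩ := A.rig.exists_play
    (f := fun w x => if x ∈ A.rig.V₀ then p w x else σ.next w x) (fun w x => by
      split_ifs with hx
      · exact hp1 w x
      · exact σ.next_edge w x (Arena.mem_owned_one.2 hx)) (.orig v)
  have hcons : ρ.ConsistentWith σ := fun j hj _ => by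
    rw [hρ, if_neg (Arena.mem_owned_one.1 hj)]
  have inv : ∀ j, ∃ u, ρ.vertex (2 * j) = .orig u ∧
      Good u (∑ i ∈ Finset.range (2 * j), (ρ.vertex i).cost) := by
    intro j
    induction j with
    | zero => exact ⟨v, h0, fun b hb => hno b (by simpa using hb)⟩
    | succ j ih =>
      obtain ⟨u, hu, hg⟩ := ih
      have e1 := ρ.rigEdge (2 * j)
      have e2 := ρ.rigEdge (2 * j + 1)
      have hsum : ∑ i ∈ Finset.range (2 * j + 1), (ρ.vertex i).cost =
          ∑ i ∈ Finset.range (2 * j), (ρ.vertex i).cost := by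
        rw [Finset.sum_range_succ, hu]
        rfl
      rw [hu] at e1
      rw [show 2 * (j + 1) = 2 * j + 1 + 1 by ring, Finset.sum_range_succ, hsum]
      by_cases hx : ρ.vertex (2 * j + 1) ∈ A.rig.V₀
      · have h1 := hρ (2 * j + 1)
        rw [if_pos hx] at h1
        obtain ⟨w, hw, hxw⟩ := hx
        rw [hxw] at e1
        have huw : u = w := by cases e1; rfl
        subst huw
        have h2 := hp2 ((List.range (2 * j + 1)).map ρ.vertex) _ u hw hxw
        rw [RigVertex.sum_map_cost, hsum, ← h1] at h2
        rw [hxw]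
        exact h2 hg
      · obtain ⟨v', hv'⟩ := e2.exists_orig e1.ne_orig
        rw [hv'] at e2
        exact ⟨v', hv', other hg e1 hx e2⟩
  have hwin := hσ ρ h0 hd hcons
  simp only [Game.IsWinning, one_ne_zero, if_false] at hwin
  refine hwin ?_
  by_cases hk : ρ.vertex ∈ atLeastDist A k
  · exact .inr hk
  · choose u hu hg using inv
    -- On `F` budget 0 suffices, so `Good` can hold there only if `k` disturbances have already been
    -- simulated.
    refine .inl ⟨u, fun j hj => hg j 0 ?_ (.base hj), hu⟩
    by_contra hlt
    exact hk (mem_atLeastDist_of_le_sum (n := 2 * j) (by omega))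

end Play

/-! ### From forcing to strategy graphs -/

/-- Minimal budgets, together with minimal numbers of rounds, decrease along optimal moves. -/
theorem Force.exists_rank {V : Type*} {M : V → Set V → ℕ → Prop} {R : Set V} {T : V → ℕ → Prop}
    (hM : ∀ v S c, M v S c → S.Finite) : ∃ r d : V → ℕ,
      (∀ v b, Force M R T v b → Force M R T v (r v) ∧ r v ≤ b) ∧
      ∀ v, Force M R T v (r v) → T v (r v) ∨ ∃ S c, M v S c ∧ ∀ v' ∈ S, Force M R T v' (r v') ∧
        r v' + c ≤ r v ∧ (r v' < r v ∨ r v' = r v ∧ d v' < d v) := by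
  let r : V → ℕ := fun v => sInf {b | Force M R T v b}
  let d : V → ℕ := fun v => sInf {n | Force.Within M R T n v (r v)}
  have hr : ∀ v b, Force M R T v b → Force M R T v (r v) ∧ r v ≤ b := fun v b h =>
    ⟨Nat.sInf_mem (s := {b | Force M R T v b}) ⟨b, h⟩,
      Nat.sInf_le (s := {b | Force M R T v b}) h⟩
  refine ⟨r, d, hr, fun v hv => ?_⟩
  have hd : Force.Within M R T (d v) v (r v) :=
    Nat.sInf_mem (s := {n | Force.Within M R T n v (r v)}) (hv.exists_within hM)
  cases hn : d v with
  | zero => rw [hn] at hd; exact .inl hd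
  | succ n =>
    rw [hn] at hd
    rcases hd with hT | ⟨S, c, b, -, hMv, hb, hS⟩
    · exact .inl hT
    · refine .inr ⟨S, c, hMv, fun v' hv' => ?_⟩
      obtain ⟨h1, h2⟩ := hr v' b (hS v' hv').force
      -- Since `r v' ≤ b` and `r v = b + c`, equality of ranks forces `r v' = b`, and then the `n`
      -- remaining rounds bound `d v'`.
      refine ⟨h1, by omega, (show r v' ≤ r v by omega).lt_or_eq.imp_right fun h => ⟨h, ?_⟩⟩
      have h3 : r v' = b := by omega
      have h4 : d v' ≤ n := Nat.sInf_le (s := {n | Force.Within M R T n v' (r v')})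
        (show Force.Within M R T n v' (r v') by rw [h3]; exact hS v' hv')
      omega

/-- The vertex of the original arena from which a vertex of the rigged arena is reached. -/
def RigVertex.src {V : Type*} {A : Arena V} : RigVertex A → V
  | .orig v => v
  | .copy v _ => v
  | .dist v _ _ => v
  | .edge v _ _ _ => v

theorem RigEdge.src_eq {V : Type*} {A : Arena V} {v : V} {x : RigVertex A}
    (h : RigEdge A (.orig v) x) : x.src = v := by
  cases h <;> rfl

open Classical in
/-- Whether a vertex of the rigged arena belongs to the original arena. -/
noncomputable def RigVertex.phase {V : Type*} {A : Arena V} (x : RigVertex A) : ℕ :=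
  if ∃ v, x = .orig v then 1 else 0

namespace PushdownSafetyGame

variable {Q Γ : Type*} [Finite Q] [Finite Γ] (G : PushdownSafetyGame Q Γ)

/-- The graph consists of the vertices won with a minimal budget below `k`, together with one
optimal auxiliary vertex for each of them outside `F`. -/
theorem nonempty_strategyGraph {k b : ℕ} (hb : b < k) {τ : Config Q Γ → ℕ}
    (h : LevelForce G.arena.Move Config.sh G.configsF 0 ((2 * k) ^ (Nat.card Q ^ 2)) τ
      ⟨G.init, []⟩ b) : Nonempty (G.StrategyGraph k) := by
  classical
  set N := (2 * k) ^ (Nat.card Q ^ 2)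
  have : Nonempty (RigVertex G.arena) := ⟨G.vI⟩
  obtain ⟨r, d, hr, hstep⟩ := Force.exists_rank (M := G.arena.Move)
    (R := {v | 0 ≤ v.sh ∧ v.sh ≤ N})
    (T := fun v b => (v ∈ G.configsF ∧ 0 ≤ v.sh ∧ v.sh ≤ N) ∨ (v.sh < 0 ∧ τ v ≤ b))
    (fun _ _ _ => G.move_finite)
  let win : Config Q Γ → Prop := fun v =>
    LevelForce G.arena.Move Config.sh G.configsF 0 N τ v (r v) ∧ r v < k
  have hch : ∀ v, win v → v ∉ G.configsF → ∃ x, RigEdge G.arena (.orig v) x ∧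
      ∀ v', RigEdge G.arena x (.orig v') → win v' ∧ r v' + x.cost ≤ r v ∧
        (r v' < r v ∨ r v' = r v ∧ d v' < d v) := by
    intro v hv hvF
    rcases hstep v hv.1 with (hT | hT) | ⟨S, c, ⟨x, hx, rfl, rfl⟩, hS⟩
    · exact absurd hT.1 hvF
    · exact absurd hT.1 (Nat.not_lt_zero _)
    · refine ⟨x, hx, fun v' hv' => ?_⟩
      obtain ⟨h1, h2, h3⟩ := hS v' hv'
      exact ⟨⟨h1, by have := hv.2; omega⟩, h2, h3⟩
  choose! ch hch1 hch2 using hch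
  let verts : Set (RigVertex G.arena) :=
    {x | win x.src ∧ (x = .orig x.src ∨ x.src ∉ G.configsF ∧ x = ch x.src)}
  let E : RigVertex G.arena → RigVertex G.arena → Prop := fun x y =>
    x ∈ verts ∧ x.src ∉ G.configsF ∧ RigEdge G.arena x y ∧ (x = .orig x.src → y = ch x.src)
  -- `r` and `d` are read at the source, hence unchanged on the first half of a round; there `phase`
  -- drops from 1 to 0.
  let m : RigVertex G.arena → ℕ ×ₗ ℕ ×ₗ ℕ := fun x => toLex (r x.src, toLex (d x.src, x.phase))
  have key : ∀ x y, E x y → y ∈ verts ∧ r y.src + x.cost ≤ r x.src ∧ m y < m x := by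
    rintro x y ⟨⟨hw, hx | ⟨-, hx⟩⟩, hF, hxy, hy⟩
    · have hy := hy hx
      have h1 := hch1 _ hw hF
      have hs : y.src = x.src := hy ▸ h1.src_eq
      refine ⟨⟨hs ▸ hw, .inr ⟨hs ▸ hF, by rw [hs]; exact hy⟩⟩, ?_, ?_⟩
      · rw [hs, hx]; exact le_rfl
      · have hpx : x.phase = 1 := if_pos ⟨_, hx⟩
        have hpy : y.phase = 0 := if_neg (by rintro ⟨u, hu⟩; exact h1.ne_orig u (hy ▸ hu))
        simp [m, Prod.Lex.toLex_lt_toLex, hs, hpx, hpy]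
    · have h1 := hch1 _ hw hF
      obtain ⟨v', rfl⟩ := hxy.exists_orig (fun v hv => h1.ne_orig v (hx ▸ hv))
      rw [hx] at hxy
      obtain ⟨h2, h3, h4⟩ := hch2 _ hw hF v' hxy
      refine ⟨⟨h2, .inl rfl⟩, ?_, ?_⟩
      · rw [← hx] at h3; exact h3
      · simp only [m, Prod.Lex.toLex_lt_toLex]
        exact h4.imp_right fun h => ⟨h.1, .inl h.2⟩
  have hheight : ∀ v, win v → v.sh ≤ N := fun v hv => hv.1.height_le
  have hfin : verts.Finite := by
    have hfs : {v | win v}.Finite := (Config.finite_sh_le N).subset hheight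
    refine ((hfs.image RigVertex.orig).union (hfs.image ch)).subset ?_
    rintro x ⟨hw, hx | ⟨-, hx⟩⟩
    · exact .inl ⟨_, hw, hx.symm⟩
    · exact .inr ⟨_, hw, hx.symm⟩
  -- As `m` decreases along edges, the graph is acyclic. So the number of vertices reachable by
  -- nonempty paths drops strictly along edges and is at most the number of all vertices, as `rankD`
  -- requires.
  let reach : RigVertex G.arena → Set (RigVertex G.arena) := fun x => {y | Relation.TransGen E x y}
  have hreach : ∀ x, reach x ⊆ verts := by
    intro x y hy
    cases hy with
    | single h => exact (key _ _ h).1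
    | tail _ h => exact (key _ _ h).1
  have hlt : ∀ x y, Relation.TransGen E x y → m y < m x := by
    intro x y hy
    induction hy with
    | single h => exact (key _ _ h).2.2
    | tail _ h ih => exact (key _ _ h).2.2.trans ih
  have hI := hr _ _ h
  refine ⟨{
    verts := verts
    edges := {p | E p.1 p.2}
    rankR := fun x => ⟨r x.1.src, x.2.1.2⟩
    rankD := fun x => (reach x.1).ncard
    rankD_le := ?_
    edges_verts := fun x y hxy => ⟨hxy.1, (key _ _ hxy).1⟩
    edges_sub := fun x y hxy => hxy.2.2.1
    init_mem := ⟨⟨hI.1, hI.2.trans_lt hb⟩, .inl rfl⟩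
    sh_le := ?_
    player_zero := ?_
    player_one := ?_
    rankR_le := fun x y hxy => (Nat.le_add_right _ _).trans (key _ _ hxy).2.1
    rankR_lt := ?_
    rankD_lt := ?_ }⟩
  · intro x
    rw [← hfin.cast_ncard_eq]
    exact Nat.cast_le.2 (Set.ncard_le_ncard (hreach _) hfin)
  · rintro x ⟨hw, hx⟩
    have hsrc := hheight _ hw
    have haux : ∀ v', RigEdge G.arena x (.orig v') → x ≠ .orig x.src → v'.sh ≤ N := by
      intro v' hv' hne
      obtain ⟨hF, hx⟩ := hx.resolve_left hne
      rw [hx] at hv'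
      exact hheight _ (hch2 _ hw hF v' hv').1
    cases x with
    | orig v => exact hsrc
    | copy v hv => exact hsrc
    | dist v v' h => exact max_le hsrc (haux v' (.ofDist v v' h) (by simp))
    | edge v v' hv h => exact max_le hsrc (haux v' (.ofEdge v v' hv h) (by simp))
  · rintro x ⟨⟨hx, hx0⟩, -⟩ y hxy
    obtain ⟨v, hv, rfl⟩ : ∃ v hv, x = .copy v hv := hx0
    have hF := (hx.2.resolve_left (by simp)).1
    exact ⟨hx, hF, hxy, fun h => by simp at h⟩
  · rintro x ⟨⟨hx, hx1⟩, hxF⟩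
    have hx1 : x ∉ G.arena.rig.V₀ := Arena.mem_owned_one.1 hx1
    by_cases horig : x = .orig x.src
    · have hF : x.src ∉ G.configsF := fun h => hxF ⟨_, h, horig⟩
      have h1 : RigEdge G.arena x (ch x.src) := by
        have := hch1 _ hx.1 hF
        rwa [← horig] at this
      exact ⟨ch x.src, ⟨h1, hx, hF, h1, fun _ => rfl⟩, fun y hy => hy.2.2.2.2 horig⟩
    · obtain ⟨hF, hxc⟩ := hx.2.resolve_left horig
      obtain ⟨y, hy⟩ := G.arena.rig.exists_succ x
      refine ⟨y, ⟨hy, hx, hF, hy, fun h => absurd h horig⟩, fun y' hy' => ?_⟩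
      refine RigEdge.eq_of_not_mem hx1 (fun v hv => horig ?_) hy'.1 hy
      rw [hv]
      rfl
  · rintro ⟨x, hx⟩ ⟨y, hy⟩ hxy hd
    have h1 := (key _ _ hxy).2.1
    cases x with
    | dist v v' hD => exact h1
    | _ => exact hd.elim
  · rintro ⟨x, hx⟩ ⟨y, hy⟩ hxy
    refine Set.ncard_lt_ncard ⟨fun z hz => .head hxy hz, fun hsub => ?_⟩ (hfin.subset (hreach _))
    exact lt_irrefl _ (hlt _ _ (hsub (.single hxy)))

/-! ### From strategy graphs to winning strategies -/

theorem StrategyGraph.winsFrom {G : PushdownSafetyGame Q Γ} {k : ℕ} (S : G.StrategyGraph k) :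
    (G.rigged k).WinsFrom 1 G.vI := by
  classical
  have hquiet : ∀ x : RigVertex G.arena, ∃ y, RigEdge G.arena x y ∧ ¬ y.IsDist := by
    intro x
    by_cases hx : ∃ v, x = .orig v
    · obtain ⟨v, rfl⟩ := hx
      by_cases hv : v ∈ G.arena.V₀
      · exact ⟨_, .toCopy v hv, id⟩
      · obtain ⟨v', h⟩ := G.arena.exists_succ v
        exact ⟨_, .toEdge v v' hv h, id⟩
    · obtain ⟨y, hy⟩ := G.arena.rig.exists_succ x
      obtain ⟨v, rfl⟩ := RigEdge.exists_orig (fun v hv => hx ⟨v, hv⟩) hy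
      exact ⟨_, hy, id⟩
  -- Player 1 follows the graph until `F` is visited, which the history shows, and from then on
  -- simulates no disturbance.
  have hnext : ∀ (w : List (RigVertex G.arena)) (x : RigVertex G.arena), ∃ y,
      (x ∈ (G.rigged k).arena.owned 1 → RigEdge G.arena x y) ∧
      (x ∈ (S.verts ∩ (G.rigged k).arena.owned 1) \ G.rigF → (∀ z ∈ w, z ∉ G.rigF) →
        (x, y) ∈ S.edges) ∧
      ((∃ z ∈ w ++ [x], z ∈ G.rigF) → ¬ y.IsDist) := by
    intro w x
    by_cases h : x ∈ (S.verts ∩ (G.rigged k).arena.owned 1) \ G.rigF ∧ ∀ z ∈ w, z ∉ G.rigF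
    · obtain ⟨y, hy, -⟩ := S.player_one x h.1
      refine ⟨y, fun _ => hy.1, fun _ _ => hy.2, ?_⟩
      rintro ⟨z, hz, hzF⟩
      rcases List.mem_append.1 hz with hz | hz
      · exact absurd hzF (h.2 z hz)
      · rw [List.mem_singleton.1 hz] at hzF
        exact absurd hzF h.1.2
    · obtain ⟨y, hy, hy'⟩ := hquiet x
      exact ⟨y, fun _ => hy, fun h1 h2 => absurd ⟨h1, h2⟩ h, fun _ => hy'⟩
  choose next h1 h2 h3 using hnext
  refine ⟨⟨next, h1⟩, fun ρ h0 _ hρ => ?_⟩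
  have hcons : ∀ j, ρ.vertex j ∈ (G.rigged k).arena.owned 1 →
      ρ.vertex (j + 1) = next ((List.range j).map ρ.vertex) (ρ.vertex j) :=
    fun j hj => hρ j hj (Play.bit_eq_false (A := G.arena) ρ j)
  have hE : ∀ j, RigEdge G.arena (ρ.vertex j) (ρ.vertex (j + 1)) :=
    Play.rigEdge (A := G.arena) ρ
  have howned : ∀ x, x ∉ (G.rigged k).arena.owned 1 → x ∈ (G.rigged k).arena.owned 0 := by
    intro x hx
    simpa [Arena.owned] using hx
  -- Both ranks act as potentials: `rankD` pays for every move, `rankR` for every disturbance.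
  have inv : ∀ n, (∀ i < n, ρ.vertex i ∉ G.rigF) → ∃ hn : ρ.vertex n ∈ S.verts,
      S.rankD ⟨_, hn⟩ + n ≤ S.rankD ⟨_, S.init_mem⟩ ∧
      (S.rankR ⟨_, hn⟩ : ℕ) + ∑ i ∈ Finset.range n, (ρ.vertex i).cost ≤
        S.rankR ⟨_, S.init_mem⟩ := by
    intro n
    induction n with
    | zero =>
      intro _
      refine ⟨h0 ▸ S.init_mem, ?_⟩
      simp [h0]
    | succ n ih =>
      intro hF
      obtain ⟨hn, hD, hR⟩ := ih fun i hi => hF i (by omega)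
      have hedge : (ρ.vertex n, ρ.vertex (n + 1)) ∈ S.edges := by
        by_cases hown : ρ.vertex n ∈ (G.rigged k).arena.owned 1
        · rw [hcons n hown]
          refine h2 _ _ ⟨⟨hn, hown⟩, hF n (by omega)⟩ fun z hz => ?_
          obtain ⟨i, hi, rfl⟩ := List.mem_map.1 hz
          exact hF i (by have := List.mem_range.1 hi; omega)
        · exact S.player_zero _ ⟨⟨hn, howned _ hown⟩, hF n (by omega)⟩ _ (hE n)
      have hn' := (S.edges_verts _ _ hedge).2
      have hD' := S.rankD_lt ⟨_, hn⟩ ⟨_, hn'⟩ hedge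
      refine ⟨hn', by omega, ?_⟩
      rw [Finset.sum_range_succ]
      have hR' : (S.rankR ⟨_, hn'⟩ : ℕ) + (ρ.vertex n).cost ≤ S.rankR ⟨_, hn⟩ := by
        have hle : (S.rankR ⟨_, hn'⟩ : ℕ) ≤ S.rankR ⟨_, hn⟩ := S.rankR_le ⟨_, hn⟩ ⟨_, hn'⟩ hedge
        by_cases hd : (ρ.vertex n).IsDist
        · have hlt : (S.rankR ⟨_, hn'⟩ : ℕ) < S.rankR ⟨_, hn⟩ :=
            S.rankR_lt ⟨_, hn⟩ ⟨_, hn'⟩ hedge hd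
          have : (ρ.vertex n).cost ≤ 1 := by cases ρ.vertex n <;> simp [RigVertex.cost]
          omega
        · have : (ρ.vertex n).cost = 0 := by
            revert hd
            cases ρ.vertex n <;> simp [RigVertex.cost, RigVertex.IsDist]
          omega
      omega
  have hvisit : ∃ n, ρ.vertex n ∈ G.rigF := by
    by_contra! hno
    obtain ⟨hn, hD, -⟩ := inv (S.rankD ⟨_, S.init_mem⟩ + 1) fun i _ => hno i
    omega
  set n := Nat.find hvisit
  obtain ⟨v, hvF, hv⟩ : ρ.vertex n ∈ G.rigF := Nat.find_spec hvisit
  obtain ⟨hn, -, hR⟩ := inv n fun i hi => Nat.find_min hvisit hi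
  simp only [Game.IsWinning, one_ne_zero, if_false]
  rintro (⟨u, hu, hρu⟩ | hdist)
  · rcases Nat.even_or_odd' n with ⟨j, hj | hj⟩
    · have := hρu j
      rw [← hj, hv, RigVertex.orig.injEq] at this
      exact hu j (this ▸ hvF)
    -- An odd position is impossible, since no two consecutive vertices are original ones.
    · have := hE (2 * j)
      rw [hρu j, ← hj, hv] at this
      exact this.ne_orig v rfl
  · refine not_mem_atLeastDist_of_sum_lt (n := n) ?_ (fun j hj => ?_) hdist
    · have := (S.rankR ⟨_, S.init_mem⟩).2
      omega
    · obtain rfl | hj := hj.eq_or_lt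
      · rw [hv]
        exact id
      · obtain ⟨i, rfl⟩ : ∃ i, j = i + 1 := ⟨j - 1, by omega⟩
        by_cases hown : ρ.vertex i ∈ (G.rigged k).arena.owned 1
        · rw [hcons i hown]
          refine h3 _ _ ⟨ρ.vertex n, ?_, ⟨v, hvF, hv⟩⟩
          have hmem : ρ.vertex n ∈ (List.range (i + 1)).map ρ.vertex :=
            List.mem_map_of_mem (List.mem_range.2 hj)
          simpa [List.range_succ] using hmem
        · obtain ⟨w, hw, hiw⟩ : ∃ w hw, ρ.vertex i = .copy w hw := howned _ hown
          obtain ⟨w', hw'⟩ := (hE i).exists_orig (fun u hu => by simp [hiw] at hu)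
          rw [hw']
          exact id

end PushdownSafetyGame

theorem mainTheorem11 {Q Γ : Type*} [Finite Q] [Finite Γ] (hΓ : Nat.card Γ = 1)
    (G : PushdownSafetyGame Q Γ) (k : ℕ) :
    (G.rigged k).WinsFrom 1 G.vI ↔ Nonempty (G.StrategyGraph k) := by
  refine ⟨fun h => ?_, fun ⟨S⟩ => S.winsFrom⟩
  obtain ⟨b, hb, hF⟩ := exists_force_of_winsFrom G.configsF k h
  exact G.nonempty_strategyGraph hb (G.exists_levelForce hΓ hb (fun _ => 0) hF)
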